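/- Let $G$ be a finite simple undirected graph with vertex set $V$, $n=|V|>6$, and let $\mathcal C$ be a set of cycles $C_1,\dots,C_k$ of $G$, of lengths $n_1,\dots,n_k\ge 2$ (a cycle of length $2$ is an edge of $G$). Two distinct cycles are called *properly interconnected* if they share exactly one vertex, or if they share exactly two vertices and these are consecutive in both cycles. Assume that $\mathcal C$ induces a *generalized $(n_1,\dots,n_k)$-puzzle*, that is, there is a subset $\mathcal C'\subseteq\mathcal C$ with at least two elements such that the graph with vertex set $\mathcal C'$, in which two cycles are adjacent if and only if they are properly interconnected, is connected, and such that every vertex of $G$ lies on at least one cycle in $\mathcal C'$. Place $n$ distinct tokens on the vertices of $G$, the tokens being labelled by the elements of $V$, so that token placements are permutations of $V$. A *shift* along a cycle $(v_1,\dots,v_j)\in\mathcal C$ moves every token lying on the cycle to the next vertex of the cycle, in one of the two directions, and leaves all other tokens in place. The *configuration group* of the puzzle is the group of all permutations of $V$ that can be reached from the identity placement by a finite sequence of shifts along cycles in $\mathcal C$. Then the configuration group is the alternating group $A_n$ of $V$ if $n_1,\dots,n_k$ are all odd, and it is the symmetric group $S_n$ of $V$ otherwise. Moreover, every permutation in the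 configuration group can be reached from the identity placement in $O(n^5)$ shifts: there is an absolute constant $K$ such that, for all such $G$ and $\mathcal C$, at most $K n^5$ shifts suffice. -/

import Mathlib

namespace CyclicShift

/-- A cycle `(v₁, v₂, …, v_j)` of the graph `G`, with `j ≥ 2`: a cyclic sequence (a list up to
rotation) of distinct vertices, any two cyclically consecutive ones being adjacent in `G`.
A cycle of length two is a single edge of `G`. -/
@[ext]
structure GraphCycle {V : Type*} (G : SimpleGraph V) where
  /-- the cyclic sequence of vertices -/
  toCycle : Cycle V
  two_le_length : 2 ≤ toCycle.length
  nodup : toCycle.Nodup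
  chain : toCycle.Chain G.Adj

namespace GraphCycle

/-- The number of vertices of a cycle. -/
def length {V : Type*} {G : SimpleGraph V} (C : GraphCycle G) : ℕ :=
  C.toCycle.length

/-- The set of vertices of a cycle. -/
def verts {V : Type*} {G : SimpleGraph V} (C : GraphCycle G) : Set V :=
  {v | v ∈ C.toCycle}

/-- The permutation `(v₁ v₂ … v_j)` of the vertices: it takes every vertex of the cycle to the
next one along the cycle and fixes all other vertices. -/
def perm {V : Type*} [DecidableEq V] {G : SimpleGraph V} (C : GraphCycle G) : Equiv.Perm V :=
  C.toCycle.formPerm C.nodup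

/-- Two (distinct) vertices are consecutive in a cycle if one is the successor of the other. -/
def Consecutive {V : Type*} [DecidableEq V] {G : SimpleGraph V} (C : GraphCycle G)
    (u v : V) : Prop :=
  u ∈ C.verts ∧ v ∈ C.verts ∧ (C.perm u = v ∨ C.perm v = u)

/-- Two cycles are properly interconnected if they share exactly one vertex, or share exactly two
vertices, which are consecutive in both cycles. -/
def ProperlyInterconnected {V : Type*} [DecidableEq V] {G : SimpleGraph V}
    (C D : GraphCycle G) : Prop :=
  (∃ v, C.verts ∩ D.verts = {v}) ∨
    ∃ u v, u ≠ v ∧ C.verts ∩ D.verts = {u, v} ∧ C.Consecutive u v ∧ D.Consecutive u v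

/-- The token placement `f'` results from `f` by moving each token on a vertex of `C` to the next
vertex along `C`, leaving all other tokens in place. -/
def Shifts {V : Type*} [DecidableEq V] {G : SimpleGraph V} (C : GraphCycle G)
    (f f' : Equiv.Perm V) : Prop :=
  ∀ v, f' (C.perm v) = f v

end GraphCycle

/-- The interconnection graph: its vertices are cycles of `G`, and two distinct cycles are joined
by an edge if and only if they are properly interconnected. -/
def interconnectionGraph {V : Type*} [DecidableEq V] (G : SimpleGraph V) :
    SimpleGraph (GraphCycle G) where
  Adj C D := C ≠ D ∧ C.ProperlyInterconnected D
  symm := ⟨by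
    rintro C D ⟨hne, h⟩
    refine ⟨hne.symm, ?_⟩
    rcases h with ⟨v, h⟩ | ⟨u, v, huv, h, hC, hD⟩
    · exact Or.inl ⟨v, by rw [Set.inter_comm, h]⟩
    · exact Or.inr ⟨u, v, huv, by rw [Set.inter_comm, h], hD, hC⟩⟩
  loopless := ⟨fun _ h => h.1 rfl⟩

/-- The set `𝒞` of cycles of `G` induces a generalized puzzle: `G` has more than six vertices, and
there is a subset `R` of `𝒞` (the relevant cycles) that contains at least two cycles, induces a
connected subgraph of the interconnection graph, and covers all vertices of `G`. -/
def IsGeneralizedPuzzle {V : Type*} [Fintype V] [DecidableEq V] {G : SimpleGraph V}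
    (𝒞 : Set (GraphCycle G)) : Prop :=
  6 < Fintype.card V ∧
    ∃ R : Set (GraphCycle G), R ⊆ 𝒞 ∧ R.Nontrivial ∧
      ((interconnectionGraph G).induce R).Connected ∧ ∀ v : V, ∃ C ∈ R, v ∈ C.verts

/-- The token-shifting graph for placements of pairwise distinct tokens (the colors being the
vertices themselves, so that a placement is a permutation of `V`): two distinct placements are
adjacent if one results from the other by shifting the tokens along a cycle in `𝒞`, in either
direction. -/
def tokenShiftingGraph {V : Type*} [DecidableEq V] {G : SimpleGraph V}
    (𝒞 : Set (GraphCycle G)) : SimpleGraph (Equiv.Perm V) where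
  Adj f f' := f ≠ f' ∧ ∃ C ∈ 𝒞, C.Shifts f f' ∨ C.Shifts f' f
  symm := ⟨by
    rintro f f' ⟨hne, C, hC, h⟩
    exact ⟨hne.symm, C, hC, h.symm⟩⟩
  loopless := ⟨fun _ h => h.1 rfl⟩

/-- Renaming the tokens maps shifting sequences to shifting sequences. -/
theorem reachable_mul_left {V : Type*} [DecidableEq V] {G : SimpleGraph V}
    {𝒞 : Set (GraphCycle G)} (g : Equiv.Perm V) {f f' : Equiv.Perm V}
    (h : (tokenShiftingGraph 𝒞).Reachable f f') :
    (tokenShiftingGraph 𝒞).Reachable (g * f) (g * f') := by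
  let φ : tokenShiftingGraph 𝒞 →g tokenShiftingGraph 𝒞 :=
    { toFun := fun f => g * f
      map_rel' := by
        rintro a b ⟨hne, C, hC, h⟩
        refine ⟨fun e => hne (mul_left_cancel e), C, hC, ?_⟩
        rcases h with h | h
        · exact Or.inl fun v => congrArg g (h v)
        · exact Or.inr fun v => congrArg g (h v) }
  exact h.map φ

/-- The configuration group generated by `𝒞`: the group of all permutations (token placements)
that are reached by shifting sequences starting from the identity token placement. -/
def configurationGroup {V : Type*} [DecidableEq V] {G : SimpleGraph V}
    (𝒞 : Set (GraphCycle G)) : Subgroup (Equiv.Perm V) where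
  carrier := {π | (tokenShiftingGraph 𝒞).Reachable 1 π}
  one_mem' := SimpleGraph.Reachable.refl _
  mul_mem' := by
    intro a b ha hb
    have h := reachable_mul_left a hb
    rw [mul_one] at h
    exact SimpleGraph.Reachable.trans ha h
  inv_mem' := by
    intro a ha
    have h := reachable_mul_left a⁻¹ ha
    rw [mul_one, inv_mul_cancel] at h
    exact h.symm

/-- The permutation `π` can be generated in at most `N` shifts, that is, some shifting sequence
of length at most `N` leads from the identity token placement to `π`. -/
def GeneratedInAtMost {V : Type*} [DecidableEq V] {G : SimpleGraph V}
    (𝒞 : Set (GraphCycle G)) (π : Equiv.Perm V) (N : ℕ) : Prop :=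
  ∃ p : (tokenShiftingGraph 𝒞).Walk 1 π, p.length ≤ N

end CyclicShift

/-! The configuration group is primitive: a block with two or more elements absorbs every relevant
cycle it meets (`isPreprimitive_of_perm_mem`). It also contains a 3-cycle costing at most 28 shifts
(`exists_isThreeCycle`), so by Jordan's theorem it contains the alternating group. A shift along a
cycle is an even permutation exactly when the length is odd, which decides between the two groups.

The 3-cycle is built from commutators of shifts along two cycles sharing a vertex or an edge. The
obstinate case is that of two 4-cycles sharing an edge: on their six vertices they generate only the
exceptional group PGL₂(5), which has no 3-cycle. Since n > 6, a third cycle leaves these six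
vertices and helps out.

For the bound, conjugating a 3-cycle depends only on where three points go, and a shortest route in
the Schreier graph on triples has fewer than n³ steps. An even permutation is a product of at most n
3-cycles, so O(n⁴) shifts already suffice. -/

open Equiv Equiv.Perm

/-! ### Commutators and products of 3-cycles -/

namespace CyclicShift

/-- If the supports of two permutations meet in exactly one point, their commutator is a
3-cycle. -/
theorem isThreeCycle_commutator {α : Type*} [Fintype α] [DecidableEq α] {f g : Perm α} {x : α}
    (hf : f x ≠ x) (hg : g x ≠ x) (h : ∀ y, f y ≠ y → g y ≠ y → y = x) :
    (f * g * f⁻¹ * g⁻¹).IsThreeCycle := by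
  have hgf : g (f x) = f x := by
    by_contra hc
    exact hf (h (f x) (fun e => hf (f.injective e)) hc)
  have hfg : f (g x) = g x := by
    by_contra hc
    exact hg (h (g x) hc (fun e => hg (g.injective e)))
  have hne : g x ≠ f x := by
    intro e
    rw [e] at hfg
    exact hf (f.injective hfg)
  -- `f * g` and `g * f` differ only at `x` and its preimages under `f` and `g`.
  have key : f * g = swap x (g x) * swap x (f x) * g * f := by
    ext w
    simp only [Perm.mul_apply]
    by_cases hfw : f w = w <;> by_cases hgw : g w = w
    · have h1 : w ≠ x := by rintro rfl; exact hf hfw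
      have h2 : w ≠ f x := by rintro rfl; exact hf (f.injective hfw)
      have h3 : w ≠ g x := by rintro rfl; exact hg (g.injective hgw)
      rw [hfw, hgw, hfw, swap_apply_of_ne_of_ne h1 h2, swap_apply_of_ne_of_ne h1 h3]
    · rw [hfw]
      by_cases hx : g w = x
      · rw [hx, swap_apply_left, swap_apply_of_ne_of_ne hf hne.symm]
      · have h1 : f (g w) = g w := by
          by_contra hc
          exact hx (h _ hc fun e => hgw (g.injective e))
        have h2 : g w ≠ f x := by
          intro e
          rw [e] at h1
          exact hf (f.injective h1)
        have h3 : g w ≠ g x := by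
          intro e
          rw [g.injective e] at hfw
          exact hf hfw
        rw [h1, swap_apply_of_ne_of_ne hx h2, swap_apply_of_ne_of_ne hx h3]
    · rw [hgw]
      by_cases hx : f w = x
      · rw [hx, swap_apply_of_ne_of_ne hg hne, swap_apply_right]
      · have h1 : g (f w) = f w := by
          by_contra hc
          exact hx (h _ (fun e => hfw (f.injective e)) hc)
        have h2 : f w ≠ g x := by
          intro e
          rw [e] at h1
          exact hg (g.injective h1)
        have h3 : f w ≠ f x := by
          intro e
          rw [f.injective e] at hgw
          exact hg hgw
        rw [h1, swap_apply_of_ne_of_ne hx h3, swap_apply_of_ne_of_ne hx h2]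
    · obtain rfl := h w hfw hgw
      rw [hfg, hgf, swap_apply_right, swap_apply_left]
  have : f * g * f⁻¹ * g⁻¹ = swap x (g x) * swap x (f x) := by
    rw [key]; group
  rw [this]
  exact isThreeCycle_swap_mul_swap_same hg.symm hf.symm hne

/-- The commutator of two permutations whose supports meet in the two points `u`, `v`, both
permutations sending `u` to `v`. -/
theorem commutator_eq_swap_mul_swap {α : Type*} [DecidableEq α] {a b : Perm α} {u v : α}
    (hau : a u = v) (hbu : b u = v) (hav : a v ≠ u) (hbv : b v ≠ u) (huv : u ≠ v)
    (h : ∀ w, a w ≠ w → b w ≠ w → w = u ∨ w = v) :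
    b * a * b⁻¹ * a⁻¹ = swap u v * swap (a v) (b v) := by
  have hav' : a v ≠ v := fun e => huv (a.injective (hau.trans e.symm))
  have hbv' : b v ≠ v := fun e => huv (b.injective (hbu.trans e.symm))
  have h1 : b (a v) = a v := by
    by_contra hc
    exact (h _ (fun e => hav' (a.injective e)) hc).elim hav hav'
  have h2 : a (b v) = b v := by
    by_contra hc
    exact (h _ hc (fun e => hbv' (b.injective e))).elim hbv hbv'
  have h3 : b v ≠ a v := by
    intro e
    rw [← e] at h1
    exact hbv' (b.injective h1)
  -- The two products differ at `u` and `v`, where the values `a v`, `b v` are interchanged, and at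
  -- the preimages of `u` under `a` and `b`, where `u`, `v` are.
  have key : b * a = swap u v * swap (a v) (b v) * a * b := by
    ext w
    simp only [Perm.mul_apply]
    by_cases hwu : w = u
    · subst hwu
      rw [hau, hbu, swap_apply_left, swap_apply_of_ne_of_ne hbv hbv']
    by_cases hwv : w = v
    · subst hwv
      rw [h1, h2, swap_apply_right, swap_apply_of_ne_of_ne hav hav']
    have hawv : a w ≠ v := fun e => hwu (a.injective (e.trans hau.symm))
    have hbwv : b w ≠ v := fun e => hwu (b.injective (e.trans hbu.symm))
    have hawa : a w ≠ a v := fun e => hwv (a.injective e)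
    have hbwb : b w ≠ b v := fun e => hwv (b.injective e)
    by_cases haw : a w = w
    · rw [haw] at hawa ⊢
      by_cases hx : b w = u
      · rw [hx, hau, swap_apply_of_ne_of_ne hav'.symm hbv'.symm, swap_apply_right]
      · have h4 : a (b w) = b w := by
          by_contra hc
          by_cases hbw : b w = w
          · rw [hbw] at hc; exact hc haw
          · exact (h _ hc fun e => hbw (b.injective e)).elim hx hbwv
        have h5 : b w ≠ a v := by
          intro e
          rw [e] at h4
          exact hav' (a.injective h4)
        rw [h4, swap_apply_of_ne_of_ne h5 hbwb, swap_apply_of_ne_of_ne hx hbwv]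
    · have hbw : b w = w := by
        by_contra hc
        exact (h _ haw hc).elim hwu hwv
      rw [hbw] at hbwb ⊢
      by_cases hx : a w = u
      · rw [hx, hbu, swap_apply_of_ne_of_ne hav.symm hbv.symm, swap_apply_left]
      · have h4 : b (a w) = a w := by
          by_contra hc
          exact (h _ (fun e => haw (a.injective e)) hc).elim hx hawv
        have h5 : a w ≠ b v := by
          intro e
          rw [e] at h4
          exact hbv' (b.injective h4)
        rw [h4, swap_apply_of_ne_of_ne hawa h5, swap_apply_of_ne_of_ne hx hawv]
  rw [key]; group

/-- An even permutation that moves a point is a 3-cycle times a permutation of smaller support. -/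
theorem exists_isThreeCycle_mul_support_lt {α : Type*} [Fintype α] [DecidableEq α] {π : Perm α}
    (hπ : sign π = 1) (h1 : π ≠ 1) :
    ∃ τ : Perm α, τ.IsThreeCycle ∧ (τ * π).support.card < π.support.card := by
  obtain ⟨x, hx⟩ : ∃ x, π x ≠ x := by
    by_contra! hc
    exact h1 (Perm.ext hc)
  have hx' : x ∈ π.support := mem_support.2 hx
  have hy' : π x ∈ π.support := apply_mem_support.2 hx'
  -- Without a third moved point, `π` would be a transposition, hence odd.
  obtain ⟨z, hz, hzx⟩ : ∃ z ∈ π.support, z ∉ ({x, π x} : Finset α) := by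
    by_contra! hc
    have h2 : π.support.card ≤ 2 := (Finset.card_le_card hc).trans Finset.card_le_two
    have h3 : π.support.card = 2 := le_antisymm h2 (two_le_card_support_of_ne_one h1)
    rw [card_support_eq_two] at h3
    rw [h3.sign_eq] at hπ
    exact absurd hπ (by decide)
  simp only [Finset.mem_insert, Finset.mem_singleton, not_or] at hzx
  -- This 3-cycle sends `π x` back to `x`, so `x` becomes fixed, and it moves only points already in
  -- the support.
  refine ⟨swap x (π x) * swap x z, isThreeCycle_swap_mul_swap_same hx.symm (Ne.symm hzx.1)
    (Ne.symm hzx.2), Finset.card_lt_card (Finset.ssubset_iff_of_subset ?_ |>.2 ⟨x, hx', ?_⟩)⟩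
  · intro w
    contrapose
    intro hw
    have h2 : w ≠ x := by rintro rfl; exact hw hx'
    have h3 : w ≠ π x := by rintro rfl; exact hw hy'
    have h4 : w ≠ z := by rintro rfl; exact hw hz
    rw [notMem_support] at hw ⊢
    rw [Perm.mul_apply, Perm.mul_apply, hw, swap_apply_of_ne_of_ne h2 h4,
      swap_apply_of_ne_of_ne h2 h3]
  · rw [notMem_support, Perm.mul_apply, Perm.mul_apply,
      swap_apply_of_ne_of_ne hx (Ne.symm hzx.2), swap_apply_right]

/-- An even permutation is a product of at most as many 3-cycles as it moves points. -/
theorem exists_list_isThreeCycle {α : Type*} [Fintype α] [DecidableEq α] (π : Perm α)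
    (hπ : sign π = 1) :
    ∃ l : List (Perm α), l.length ≤ π.support.card ∧ (∀ σ ∈ l, σ.IsThreeCycle) ∧ l.prod = π := by
  induction hn : π.support.card using Nat.strong_induction_on generalizing π with
  | _ n ih =>
    by_cases h1 : π = 1
    · exact ⟨[], by simp, by simp, by simp [h1]⟩
    · obtain ⟨τ, hτ, hlt⟩ := exists_isThreeCycle_mul_support_lt hπ h1
      obtain ⟨l, hl, hl', hp⟩ := ih _ (hn ▸ hlt) (τ * π) (by rw [Perm.sign_mul, hτ.sign, hπ, one_mul]) rfl
      refine ⟨τ⁻¹ :: l, by simp only [List.length_cons]; omega, ?_, by simp [hp]⟩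
      simp only [List.mem_cons, forall_eq_or_imp]
      exact ⟨hτ.inv, hl'⟩

end CyclicShift

/-! ### Counting shifts -/

namespace CyclicShift

variable {V : Type*} [DecidableEq V] {G : SimpleGraph V} {𝒞 : Set (GraphCycle G)}

namespace GeneratedInAtMost

theorem mono {π : Perm V} {M N : ℕ} (h : GeneratedInAtMost 𝒞 π M) (hMN : M ≤ N) :
    GeneratedInAtMost 𝒞 π N :=
  let ⟨p, hp⟩ := h
  ⟨p, hp.trans hMN⟩

theorem one : GeneratedInAtMost 𝒞 1 0 := ⟨.nil, le_rfl⟩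

theorem mem {π : Perm V} {N : ℕ} (h : GeneratedInAtMost 𝒞 π N) : π ∈ configurationGroup 𝒞 :=
  let ⟨p, _⟩ := h
  p.reachable

/-- Shifts multiply on the right, so they commute with renaming tokens on the left. -/
theorem exists_walk_mul_left (g : Perm V) {f f' : Perm V} (p : (tokenShiftingGraph 𝒞).Walk f f') :
    ∃ q : (tokenShiftingGraph 𝒞).Walk (g * f) (g * f'), q.length = p.length := by
  let φ : tokenShiftingGraph 𝒞 →g tokenShiftingGraph 𝒞 :=
    { toFun := fun f => g * f
      map_rel' := by
        rintro a b ⟨hne, C, hC, h⟩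
        refine ⟨fun e => hne (mul_left_cancel e), C, hC, ?_⟩
        rcases h with h | h
        · exact Or.inl fun v => congrArg g (h v)
        · exact Or.inr fun v => congrArg g (h v) }
  exact ⟨p.map φ, p.length_map φ⟩

theorem mul {π ρ : Perm V} {M N : ℕ} (hπ : GeneratedInAtMost 𝒞 π M)
    (hρ : GeneratedInAtMost 𝒞 ρ N) : GeneratedInAtMost 𝒞 (π * ρ) (M + N) := by
  obtain ⟨p, hp⟩ := hπ
  obtain ⟨q, hq⟩ := hρ
  obtain ⟨r, hr⟩ := exists_walk_mul_left π q
  refine ⟨p.append (r.copy (mul_one π) rfl), ?_⟩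
  rw [SimpleGraph.Walk.length_append, SimpleGraph.Walk.length_copy]
  omega

theorem inv {π : Perm V} {N : ℕ} (hπ : GeneratedInAtMost 𝒞 π N) :
    GeneratedInAtMost 𝒞 π⁻¹ N := by
  obtain ⟨p, hp⟩ := hπ
  obtain ⟨r, hr⟩ := exists_walk_mul_left π⁻¹ p
  refine ⟨(r.copy (mul_one _) (inv_mul_cancel π)).reverse, ?_⟩
  rw [SimpleGraph.Walk.length_reverse, SimpleGraph.Walk.length_copy]
  omega

theorem perm {C : GraphCycle G} (hC : C ∈ 𝒞) : GeneratedInAtMost 𝒞 C.perm 1 := by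
  by_cases h : (1 : Perm V) = C.perm
  · rw [← h]
    exact one.mono zero_le_one
  · have hadj : (tokenShiftingGraph 𝒞).Adj 1 C.perm :=
      ⟨h, C, hC, Or.inr fun v => rfl⟩
    exact ⟨hadj.toWalk, by simp⟩

theorem prod {l : List (Perm V)} {N : ℕ} (h : ∀ σ ∈ l, GeneratedInAtMost 𝒞 σ N) :
    GeneratedInAtMost 𝒞 l.prod (l.length * N) := by
  induction l with
  | nil => simpa using one
  | cons σ l ih =>
    simp only [List.mem_cons, forall_eq_or_imp] at h
    rw [List.prod_cons, List.length_cons, add_mul, one_mul, add_comm]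
    exact h.1.mul (ih h.2)

end GeneratedInAtMost

/-- Adjacent placements differ by right multiplication with a permutation generated in one
shift. -/
theorem exists_eq_mul_of_adj {f f' : Perm V} (h : (tokenShiftingGraph 𝒞).Adj f f') :
    ∃ s, GeneratedInAtMost 𝒞 s 1 ∧ f' = f * s := by
  obtain ⟨-, C, hC, h | h⟩ := h
  · refine ⟨C.perm⁻¹, (GeneratedInAtMost.perm hC).inv, ?_⟩
    rw [eq_mul_inv_iff_mul_eq]
    exact Perm.ext h
  · exact ⟨C.perm, GeneratedInAtMost.perm hC, (Perm.ext fun v => h v).symm⟩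

/-- Induction over the configuration group, appending one shift at a time. -/
theorem configurationGroup_induction {P : Perm V → Prop} (one : P 1)
    (mul : ∀ f s, P f → GeneratedInAtMost 𝒞 s 1 → P (f * s)) {π : Perm V}
    (hπ : π ∈ configurationGroup 𝒞) : P π := by
  have h : Relation.ReflTransGen (tokenShiftingGraph 𝒞).Adj 1 π :=
    (SimpleGraph.reachable_iff_reflTransGen _ _).1 hπ
  induction h with
  | refl => exact one
  | tail _ hadj ih =>
    obtain ⟨s, hs, rfl⟩ := exists_eq_mul_of_adj hadj
    exact mul _ _ (ih ((SimpleGraph.reachable_iff_reflTransGen _ _).2 (by assumption))) hs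

/-- The Schreier graph of an action of the permutations of `V`: two points are adjacent if some
shift takes one to the other. -/
def schreierGraph (𝒞 : Set (GraphCycle G)) (X : Type*) [MulAction (Perm V) X] :
    SimpleGraph X where
  Adj x y := x ≠ y ∧ ∃ s : Perm V, GeneratedInAtMost 𝒞 s 1 ∧ s • x = y
  symm := ⟨by
    rintro x y ⟨hne, s, hs, rfl⟩
    exact ⟨hne.symm, s⁻¹, hs.inv, inv_smul_smul s x⟩⟩
  loopless := ⟨fun _ h => h.1 rfl⟩

theorem exists_generatedInAtMost_of_walk {X : Type*} [MulAction (Perm V) X] {x y : X}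
    (p : (schreierGraph 𝒞 X).Walk x y) :
    ∃ g : Perm V, GeneratedInAtMost 𝒞 g p.length ∧ g • x = y := by
  induction p with
  | nil => exact ⟨1, .one, one_smul _ _⟩
  | cons h p ih =>
    obtain ⟨g, hg, hgy⟩ := ih
    obtain ⟨-, s, hs, rfl⟩ := h
    exact ⟨g * s, hg.mul hs, by rw [mul_smul, hgy]⟩

/-- Whatever an element of the configuration group does to one point of a finite set on which the
permutations act, is done by few shifts. -/
theorem exists_generatedInAtMost_smul_eq {X : Type*} [Fintype X] [MulAction (Perm V) X]
    {h : Perm V} (hh : h ∈ configurationGroup 𝒞) (x : X) :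
    ∃ g : Perm V, GeneratedInAtMost 𝒞 g (Fintype.card X) ∧ g • x = h • x := by
  classical
  have hreach : (schreierGraph 𝒞 X).Reachable x (h • x) := by
    revert x
    refine configurationGroup_induction (P := fun h => ∀ x, (schreierGraph 𝒞 X).Reachable x (h • x))
      (fun x => by rw [one_smul]) (fun f s hf hs x => ?_) hh
    by_cases hx : x = s • x
    · have := hf x
      rwa [mul_smul, ← hx]
    · have hadj : (schreierGraph 𝒞 X).Adj x (s • x) := ⟨hx, s, hs, rfl⟩
      rw [mul_smul]
      exact hadj.reachable.trans (hf _)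
  -- A path repeats no point, so its length is below the number of points of `X`.
  obtain ⟨p⟩ := hreach
  obtain ⟨g, hg, hgx⟩ := exists_generatedInAtMost_of_walk p.bypass
  exact ⟨g, hg.mono p.bypass_isPath.length_lt.le, hgx⟩

section

variable [Fintype V]

/-- If one 3-cycle takes at most `T` shifts and the configuration group contains all even
permutations, every 3-cycle takes at most `2 n³ + T` shifts. -/
theorem generatedInAtMost_of_isThreeCycle (hA : alternatingGroup V ≤ configurationGroup 𝒞)
    (h5 : 5 ≤ Fintype.card V) {g σ : Perm V} {T : ℕ} (hg : g.IsThreeCycle)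
    (hgT : GeneratedInAtMost 𝒞 g T) (hσ : σ.IsThreeCycle) :
    GeneratedInAtMost 𝒞 σ (2 * Fintype.card V ^ 3 + T) := by
  obtain ⟨c, hc⟩ := isConj_iff.1 (alternatingGroup.isThreeCycle_isConj
    (by rwa [Nat.card_eq_fintype_card]) (σ := ⟨g, hg.mem_alternatingGroup⟩)
    (τ := ⟨σ, hσ.mem_alternatingGroup⟩) hg hσ)
  have hc' : (c : Perm V) * g * (c : Perm V)⁻¹ = σ := congrArg Subtype.val hc
  obtain ⟨x, y, z, hxyz⟩ := Finset.card_eq_three.1 hg.card_support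
  -- The conjugator `c` may be long; `k` agrees with it on the support of `g` and is cheap.
  obtain ⟨k, hk, hkc⟩ := exists_generatedInAtMost_smul_eq (hA c.2) (x, y, z)
  have hcard : Fintype.card (V × V × V) = Fintype.card V ^ 3 := by
    rw [Fintype.card_prod, Fintype.card_prod]; ring
  rw [hcard] at hk
  simp only [Prod.smul_mk, Perm.smul_def, Prod.mk.injEq] at hkc
  have hkσ : k * g * k⁻¹ = σ := by
    -- Since `k⁻¹ * c` fixes the support of `g` pointwise, it commutes with `g`.
    have hd : Perm.Disjoint (k⁻¹ * (c : Perm V)) g := by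
      intro w
      by_cases hw : w ∈ g.support
      · left
        have h3 := hxyz.2.2.2
        rw [h3] at hw
        simp only [Finset.mem_insert, Finset.mem_singleton] at hw
        rw [Perm.mul_apply, Perm.inv_eq_iff_eq]
        rcases hw with rfl | rfl | rfl
        · exact hkc.1.symm
        · exact hkc.2.1.symm
        · exact hkc.2.2.symm
      · exact Or.inr (notMem_support.1 hw)
    rw [← hc']
    have h4 := hd.commute.eq
    calc k * g * k⁻¹ = k * (g * (k⁻¹ * (c : Perm V))) * (c : Perm V)⁻¹ := by group
      _ = k * ((k⁻¹ * (c : Perm V)) * g) * (c : Perm V)⁻¹ := by rw [h4]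
      _ = c * g * (c : Perm V)⁻¹ := by group
  rw [← hkσ]
  exact ((hk.mul hgT).mul hk.inv).mono (by omega)

theorem generatedInAtMost_of_sign_eq_one (hA : alternatingGroup V ≤ configurationGroup 𝒞)
    (h5 : 5 ≤ Fintype.card V) {g π : Perm V} {T : ℕ} (hg : g.IsThreeCycle)
    (hgT : GeneratedInAtMost 𝒞 g T) (hπ : sign π = 1) :
    GeneratedInAtMost 𝒞 π (Fintype.card V * (2 * Fintype.card V ^ 3 + T)) := by
  obtain ⟨l, hl, h3, rfl⟩ := exists_list_isThreeCycle π hπ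
  refine (GeneratedInAtMost.prod fun σ hσ =>
    generatedInAtMost_of_isThreeCycle hA h5 hg hgT (h3 σ hσ)).mono ?_
  exact Nat.mul_le_mul_right _ (hl.trans (Finset.card_le_univ _))

end

/-! ### Cycles of the graph as permutations -/

namespace GraphCycle

variable (C : GraphCycle G)

theorem nontrivial {W : Type*} {H : SimpleGraph W} (C : GraphCycle H) : C.toCycle.Nontrivial := by
  obtain ⟨⟨l⟩, h2, hn, -⟩ := C
  exact (Cycle.nontrivial_coe_nodup_iff hn).2 h2

theorem coe_toFinset : (C.toCycle.toFinset : Set V) = C.verts := by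
  obtain ⟨⟨l⟩, h2, hn, -⟩ := C
  ext v
  simp [verts]

theorem card_toFinset : C.toCycle.toFinset.card = C.length := by
  obtain ⟨⟨l⟩, h2, hn, -⟩ := C
  exact List.toFinset_card_of_nodup hn

theorem isCycleOn_perm : C.perm.IsCycleOn (C.toCycle.toFinset : Set V) := by
  rw [coe_toFinset]
  obtain ⟨⟨l⟩, h2, hn, -⟩ := C
  exact List.Nodup.isCycleOn_formPerm hn

theorem perm_apply_ne_iff {v : V} : C.perm v ≠ v ↔ v ∈ C.verts := by
  constructor
  · contrapose!
    exact Cycle.formPerm_eq_self_of_notMem _ _ v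
  · intro hv
    have h := C.isCycleOn_perm
    rw [coe_toFinset] at h
    refine h.apply_ne ?_ hv
    rw [← coe_toFinset]
    refine Finset.one_lt_card_iff_nontrivial.1 ?_
    rw [card_toFinset]
    exact C.two_le_length

theorem sign_perm [Fintype V] : sign C.perm = -(-1) ^ C.length := by
  rw [perm, (Cycle.isCycle_formPerm _ _ C.nontrivial).sign,
    Cycle.support_formPerm _ _ C.nontrivial, card_toFinset]

end GraphCycle

end CyclicShift

/-! ### Primitivity -/

namespace CyclicShift

open scoped Pointwise

variable {V : Type*} [DecidableEq V] {G : SimpleGraph V} {𝒞 R : Set (GraphCycle G)}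

theorem GraphCycle.ProperlyInterconnected.nonempty {C D : GraphCycle G}
    (h : C.ProperlyInterconnected D) : (C.verts ∩ D.verts).Nonempty := by
  rcases h with ⟨v, h⟩ | ⟨u, v, -, h, -⟩ <;> rw [h]
  · exact ⟨v, rfl⟩
  · exact ⟨u, Or.inl rfl⟩

/-- A nonempty set of vertices that contains every relevant cycle it meets contains all
vertices. -/
theorem eq_univ_of_forall_subset (hR : ((interconnectionGraph G).induce R).Connected)
    (hcov : ∀ v : V, ∃ C ∈ R, v ∈ C.verts) {S : Set V} (hS : S.Nonempty)
    (h : ∀ C ∈ R, (C.verts ∩ S).Nonempty → C.verts ⊆ S) : S = Set.univ := by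
  obtain ⟨x, hx⟩ := hS
  obtain ⟨C, hC, hxC⟩ := hcov x
  have hCS := h C hC ⟨x, hxC, hx⟩
  refine Set.eq_univ_of_forall fun y => ?_
  obtain ⟨D, hD, hyD⟩ := hcov y
  -- Interconnected cycles share a vertex, so containment in `S` spreads along the interconnection
  -- graph.
  have key : ∀ E : R, Relation.ReflTransGen ((interconnectionGraph G).induce R).Adj ⟨C, hC⟩ E →
      E.1.verts ⊆ S := by
    intro E hE
    induction hE with
    | refl => exact hCS
    | @tail E F _ hadj ih =>
      obtain ⟨v, hvE, hvF⟩ := (hadj : (interconnectionGraph G).Adj E.1 F.1).2.nonempty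
      exact h F.1 F.2 ⟨v, hvF, ih hvE⟩
  exact key ⟨D, hD⟩ ((SimpleGraph.reachable_iff_reflTransGen _ _).1 (hR.preconnected _ _)) hyD

theorem exists_properlyInterconnected (hR : ((interconnectionGraph G).induce R).Connected)
    (hnt : R.Nontrivial) {C : GraphCycle G} (hC : C ∈ R) :
    ∃ D ∈ R, C ≠ D ∧ C.ProperlyInterconnected D := by
  have : Nontrivial R := hnt.coe_sort
  obtain ⟨D, hD⟩ := hR.preconnected.exists_adj_of_nontrivial ⟨C, hC⟩
  exact ⟨D.1, D.2, hD⟩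

/-- A block of a permutation group containing the cycle `C` either contains `C`, or is contained
in it, or is disjoint from it. -/
theorem subset_or_verts_subset_of_isBlock {H : Subgroup (Perm V)} {B : Set V}
    (hB : MulAction.IsBlock H B) {C : GraphCycle G} (hC : C.perm ∈ H)
    (hne : (C.verts ∩ B).Nonempty) : B ⊆ C.verts ∨ C.verts ⊆ B := by
  rw [or_iff_not_imp_left, Set.not_subset]
  rintro ⟨w, hwB, hwC⟩
  obtain ⟨x, hxC, hxB⟩ := hne
  -- The shift fixes `w ∈ B`, so it stabilizes the block; its powers then carry `x` all around `C`.
  have hfix : (⟨C.perm, hC⟩ : H) • B = B := by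
    refine MulAction.isBlock_iff_smul_eq_of_mem.1 hB hwB ?_
    have : C.perm w = w := by
      by_contra hc
      exact hwC (C.perm_apply_ne_iff.1 hc)
    change C.perm w ∈ B
    rwa [this]
  intro y hy
  have hcyc := C.isCycleOn_perm
  rw [GraphCycle.coe_toFinset] at hcyc
  obtain ⟨i, rfl⟩ := hcyc.2 hxC hy
  have hz : (⟨C.perm, hC⟩ : H) ^ i ∈ MulAction.stabilizer H B := zpow_mem hfix i
  rw [← MulAction.mem_stabilizer_iff.1 hz]
  exact Set.smul_mem_smul_set hxB

/-- The shift takes one of the two points of `B` to the other, hence stabilizes `B`. -/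
theorem verts_subset_of_isBlock_of_consecutive {H : Subgroup (Perm V)} {B : Set V}
    (hB : MulAction.IsBlock H B) {C : GraphCycle G} (hC : C.perm ∈ H) {u v : V} (hu : u ∈ B)
    (hv : v ∈ B) (h : C.Consecutive u v) : C.verts ⊆ B := by
  obtain ⟨huC, hvC, h⟩ := h
  have hfix : (⟨C.perm, hC⟩ : H) • B = B := by
    rcases h with h | h
    · exact MulAction.isBlock_iff_smul_eq_of_mem.1 hB hu (by change C.perm u ∈ B; rwa [h])
    · exact MulAction.isBlock_iff_smul_eq_of_mem.1 hB hv (by change C.perm v ∈ B; rwa [h])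
  intro y hy
  have hcyc := C.isCycleOn_perm
  rw [GraphCycle.coe_toFinset] at hcyc
  obtain ⟨i, rfl⟩ := hcyc.2 huC hy
  have hz : (⟨C.perm, hC⟩ : H) ^ i ∈ MulAction.stabilizer H B := zpow_mem hfix i
  rw [← MulAction.mem_stabilizer_iff.1 hz]
  exact Set.smul_mem_smul_set hu

theorem GraphCycle.nontrivial_verts (C : GraphCycle G) : C.verts.Nontrivial := by
  rw [← C.coe_toFinset]
  refine Finset.one_lt_card_iff_nontrivial.1 ?_
  rw [C.card_toFinset]
  exact C.two_le_length

/-- A block with at least two elements that contains a common vertex of two properly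
interconnected cycles contains both cycles. -/
theorem verts_subset_of_isBlock {H : Subgroup (Perm V)} {B : Set V} (hB : MulAction.IsBlock H B)
    (hBnt : B.Nontrivial) {C D : GraphCycle G} (hC : C.perm ∈ H) (hD : D.perm ∈ H)
    (hCD : C.ProperlyInterconnected D) {v : V} (hv : v ∈ C.verts ∩ D.verts) (hvB : v ∈ B) :
    C.verts ⊆ B := by
  rcases subset_or_verts_subset_of_isBlock hB hC ⟨v, hv.1, hvB⟩ with hBC | h
  swap
  · exact h
  rcases hCD with ⟨w, hw⟩ | ⟨x, y, hxy, hw, hCc, hDc⟩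
  · rcases subset_or_verts_subset_of_isBlock hB hD ⟨v, hv.2, hvB⟩ with hBD | h
    · have : B ⊆ {w} := hw ▸ Set.subset_inter hBC hBD
      exact absurd (Set.subsingleton_singleton.anti this) hBnt.not_subsingleton
    · have : D.verts ⊆ {w} := hw ▸ Set.subset_inter (h.trans hBC) subset_rfl
      exact absurd (Set.subsingleton_singleton.anti this) D.nontrivial_verts.not_subsingleton
  -- Both shared vertices lie in `B`: either `D` is inside `B`, or `B` is a set of two elements
  -- inside the intersection and so equals it.
  · have key : x ∈ B → y ∈ B → C.verts ⊆ B := fun hx hy =>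
      verts_subset_of_isBlock_of_consecutive hB hC hx hy hCc
    rcases subset_or_verts_subset_of_isBlock hB hD ⟨v, hv.2, hvB⟩ with hBD | h
    · have hsub : B ⊆ {x, y} := hw ▸ Set.subset_inter hBC hBD
      have heq : B = {x, y} := by
        obtain ⟨p, hp, q, hq, hpq⟩ := hBnt
        refine hsub.antisymm ?_
        rintro z (rfl | rfl)
        · rcases hsub hp with rfl | rfl
          · exact hp
          · rcases hsub hq with rfl | rfl
            · exact hq
            · exact absurd rfl hpq
        · rcases hsub hp with rfl | rfl
          · rcases hsub hq with rfl | rfl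
            · exact absurd rfl hpq
            · exact hq
          · exact hp
      exact key (by simp [heq]) (by simp [heq])
    · exact key (h hDc.1) (h hDc.2.1)

/-- Orbits, and likewise nontrivial blocks, absorb each relevant cycle they meet. For a block,
rotate it along `C` until it contains a vertex shared with a neighbouring cycle; the translate then
contains `C`, so it meets the original block and equals it. -/
theorem isPreprimitive_of_perm_mem (hR : ((interconnectionGraph G).induce R).Connected)
    (hnt : R.Nontrivial) (hcov : ∀ v : V, ∃ C ∈ R, v ∈ C.verts) {H : Subgroup (Perm V)}
    (hH : ∀ C ∈ R, C.perm ∈ H) : MulAction.IsPreprimitive H V := by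
  have hmove : ∀ C ∈ R, ∀ x ∈ C.verts, ∀ y ∈ C.verts, ∃ h : H, h • x = y := by
    intro C hC x hx y hy
    have hcyc := C.isCycleOn_perm
    rw [GraphCycle.coe_toFinset] at hcyc
    obtain ⟨i, hi⟩ := hcyc.2 hx hy
    exact ⟨⟨C.perm ^ i, zpow_mem (hH C hC) i⟩, hi⟩
  have htrans : MulAction.IsPretransitive H V := by
    refine ⟨fun x y => ?_⟩
    have : MulAction.orbit H x = Set.univ := by
      refine eq_univ_of_forall_subset hR hcov ⟨x, MulAction.mem_orbit_self x⟩ ?_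
      rintro C hC ⟨z, hzC, hz⟩ w hw
      obtain ⟨h, rfl⟩ := hmove C hC z hzC w hw
      exact MulAction.mem_orbit_of_mem_orbit h hz
    exact (this ▸ Set.mem_univ y : y ∈ MulAction.orbit H x)
  refine { htrans with isTrivialBlock_of_isBlock := fun {B} hB => ?_ }
  refine or_iff_not_imp_left.2 fun hBs => ?_
  rw [Set.not_subsingleton_iff] at hBs
  refine eq_univ_of_forall_subset hR hcov hBs.nonempty ?_
  rintro C hC ⟨x, hxC, hxB⟩
  obtain ⟨D, hD, -, hCD⟩ := exists_properlyInterconnected hR hnt hC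
  obtain ⟨v, hv⟩ := hCD.nonempty
  obtain ⟨h, rfl⟩ := hmove C hC x hxC v hv.1
  have hsub : C.verts ⊆ h • B :=
    verts_subset_of_isBlock (hB.translate h) (hBs.image (MulAction.injective h)) (hH C hC)
      (hH D hD) hCD hv (Set.smul_mem_smul_set hxB)
  have heq : h • B = B := by
    have := hB.smul_eq_smul_of_nonempty (g₁ := h) (g₂ := 1)
      ⟨x, hsub hxC, by rwa [one_smul]⟩
    rwa [one_smul] at this
  rwa [heq] at hsub

end CyclicShift

/-! ### 3-cycles from words in two permutations -/

namespace CyclicShift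

theorem commute_swap_swap {α : Type*} [DecidableEq α] {p q r s : α} (hpr : p ≠ r) (hps : p ≠ s)
    (hqr : q ≠ r) (hqs : q ≠ s) : Commute (swap p q) (swap r s) := by
  refine Disjoint.commute fun w => ?_
  by_cases hp : w = p
  · subst hp; exact Or.inr (swap_apply_of_ne_of_ne hpr hps)
  · by_cases hq : w = q
    · subst hq; exact Or.inr (swap_apply_of_ne_of_ne hqr hqs)
    · exact Or.inl (swap_apply_of_ne_of_ne hp hq)

/-- For two permutations whose supports meet in the two points `u`, `v`, both sending `u` to `v`,
where the cycles of `u` have length at least four and five, respectively, the square of a product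
of commutators is a 3-cycle. -/
theorem isThreeCycle_sq_commutator_mul {α : Type*} [Fintype α] [DecidableEq α] {a b : Perm α}
    {u v : α} (hau : a u = v) (hbu : b u = v) (huv : u ≠ v)
    (h : ∀ w, a w ≠ w → b w ≠ w → w = u ∨ w = v)
    (ha2 : a v ≠ u) (ha3 : a (a v) ≠ u) (hb2 : b v ≠ u) (hb3 : b (b v) ≠ u)
    (hb4 : b (b (b v)) ≠ u) :
    ((b * a * b⁻¹ * a⁻¹ * ((b * b * b) * (b⁻¹ * a⁻¹ * b * a) * (b * b * b)⁻¹)) *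
      (b * a * b⁻¹ * a⁻¹ * ((b * b * b) * (b⁻¹ * a⁻¹ * b * a) * (b * b * b)⁻¹))).IsThreeCycle := by
  have hau' : a⁻¹ v = u := by rw [Perm.inv_eq_iff_eq, hau]
  have hbu' : b⁻¹ v = u := by rw [Perm.inv_eq_iff_eq, hbu]
  have hx : a (a⁻¹ u) = u := a.apply_symm_apply u
  have hy : b (b⁻¹ u) = u := b.apply_symm_apply u
  have hk1 := commutator_eq_swap_mul_swap hau hbu ha2 hb2 huv h
  have hk2 := commutator_eq_swap_mul_swap (a := a⁻¹) (b := b⁻¹) hau' hbu'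
    (fun e => ha2 (by rw [← e, hx])) (fun e => hb2 (by rw [← e, hy])) huv.symm
    (fun w hw hw' => (h w (fun e => hw (by rw [Perm.inv_eq_iff_eq, e]))
      (fun e => hw' (by rw [Perm.inv_eq_iff_eq, e]))).symm)
  rw [inv_inv, inv_inv] at hk2
  have hxav : a⁻¹ u ≠ v := fun e => ha2 (by rw [← e, hx])
  have hxau : a⁻¹ u ≠ u := fun e => huv (by rw [← hau]; nth_rewrite 1 [← hx]; rw [e])
  -- points off the common edge are moved by one permutation only
  have hoff_a : ∀ w, a w ≠ w → w ≠ u → w ≠ v → b w = w := fun w hw hwu hwv => by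
    by_contra hc
    exact (h w hw hc).elim hwu hwv
  have hbx : b (a⁻¹ u) = a⁻¹ u :=
    hoff_a _ (by rw [hx]; exact hxau.symm) hxau hxav
  have hav' : a v ≠ v := fun e => huv (a.injective (hau.trans e.symm))
  have hbx1 : b (a v) = a v := hoff_a _ (fun e => hav' (a.injective e)) ha2 hav'
  have hbv' : b v ≠ v := fun e => huv (b.injective (hbu.trans e.symm))
  -- Conjugation by `b³` moves the second pair of transpositions so that it shares with the first
  -- pair only the point `b v`.
  have hk3 : (b * b * b) * (b⁻¹ * a⁻¹ * b * a) * (b * b * b)⁻¹ =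
      swap (b (b v)) (b (b (b v))) * swap (b v) (a⁻¹ u) := by
    rw [hk2]
    have e1 : swap (b (b v)) (b (b (b v))) = (b * b * b) * swap u v * (b * b * b)⁻¹ := by
      rw [← swap_apply_apply]; simp only [Perm.mul_apply, hbu]
    have e2 : swap (b v) (a⁻¹ u) = (b * b * b) * swap (b⁻¹ u) (a⁻¹ u) * (b * b * b)⁻¹ := by
      rw [← swap_apply_apply]; simp only [Perm.mul_apply, hbx, hy, hbu]
    rw [e1, e2, swap_comm v u, swap_comm (a⁻¹ u)]
    group
  rw [hk1, hk3, swap_comm (a v)]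
  -- a point moved by `b` is none of the points moved by `a` only
  have hne : ∀ w, b w ≠ w → w ≠ a v ∧ w ≠ a⁻¹ u := fun w hw =>
    ⟨fun e => hw (e ▸ hbx1), fun e => hw (e ▸ hbx)⟩
  have hm1 : b (b v) ≠ b v := fun e => hbv' (b.injective e)
  have hm2 : b (b (b v)) ≠ b (b v) := fun e => hm1 (b.injective e)
  have hm3 : b (b (b (b v))) ≠ b (b (b v)) := fun e => hm2 (b.injective e)
  have hn1 : b (b v) ≠ v := fun e => hb2 (b.injective (e.trans hbu.symm))
  have hn2 : b (b (b v)) ≠ v := fun e => hb3 (b.injective (e.trans hbu.symm))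
  have hn3 : b (b (b v)) ≠ b v := fun e => hn1 (b.injective e)
  have hbu0 : b u ≠ u := by rw [hbu]; exact huv.symm
  have c1 : Commute (swap u v) (swap (b (b v)) (b (b (b v)))) :=
    commute_swap_swap hb3.symm hb4.symm hn1.symm hn2.symm
  have c2 : Commute (swap u v) (swap (b v) (a v)) :=
    commute_swap_swap hb2.symm (hne _ hbu0).1 hbv'.symm hav'.symm
  have c3 : Commute (swap u v) (swap (b v) (a⁻¹ u)) :=
    commute_swap_swap hb2.symm hxau.symm hbv'.symm hxav.symm
  have c4 : Commute (swap (b (b v)) (b (b (b v)))) (swap (b v) (a v)) :=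
    commute_swap_swap hm1 (hne _ hm2).1 hn3 (hne _ hm3).1
  have c5 : Commute (swap (b (b v)) (b (b (b v)))) (swap (b v) (a⁻¹ u)) :=
    commute_swap_swap hm1 (hne _ hm2).2 hn3 (hne _ hm3).2
  have ht : (swap (b v) (a v) * swap (b v) (a⁻¹ u)).IsThreeCycle :=
    isThreeCycle_swap_mul_swap_same (hne _ hm1).1 (hne _ hm1).2
      (fun e => ha3 (by rw [e, hx]))
  have hc : Commute (swap u v * swap (b (b v)) (b (b (b v))))
      (swap (b v) (a v) * swap (b v) (a⁻¹ u)) :=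
    (c2.mul_right c3).mul_left (c4.mul_right c5)
  -- The product is an involution times a disjoint 3-cycle; squaring kills the involution.
  have hs : swap u v * swap (b v) (a v) *
      (swap (b (b v)) (b (b (b v))) * swap (b v) (a⁻¹ u)) =
      (swap u v * swap (b (b v)) (b (b (b v)))) * (swap (b v) (a v) * swap (b v) (a⁻¹ u)) :=
    c4.symm.mul_mul_mul_comm _ _
  have h1 : (swap u v * swap (b (b v)) (b (b (b v)))) *
      (swap u v * swap (b (b v)) (b (b (b v)))) = 1 := by
    rw [c1.symm.mul_mul_mul_comm, swap_mul_self, swap_mul_self, one_mul]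
  rw [hs, hc.symm.mul_mul_mul_comm, h1, one_mul]
  exact ht.isThreeCycle_sq

/-- The product of a word in two permutations. -/
def wordPerm {α : Type*} (a b : Perm α) (l : List Bool) : Perm α :=
  (l.map fun i => if i then b else a).prod

/-- The action of a word on the six vertices of two 4-cycles `(0 1 2 3)` and `(0 1 4 5)` sharing
an edge. -/
def wordFun (l : List Bool) (i : Fin 6) : Fin 6 :=
  l.foldr (fun c j => if c then ![1, 4, 2, 3, 5, 0] j else ![1, 2, 3, 0, 4, 5] j) i

theorem wordPerm_apply {α : Type*} {a b : Perm α} {e : Fin 6 → α}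
    (ha : ∀ i, a (e i) = e (![1, 2, 3, 0, 4, 5] i))
    (hb : ∀ i, b (e i) = e (![1, 4, 2, 3, 5, 0] i)) (l : List Bool) (i : Fin 6) :
    wordPerm a b l (e i) = e (wordFun l i) := by
  induction l with
  | nil => rfl
  | cons c l ih =>
    have h : wordPerm a b (c :: l) = (if c then b else a) * wordPerm a b l := by
      simp [wordPerm]
    rw [h, Perm.mul_apply, ih]
    cases c
    · exact ha _
    · exact hb _

/-- Words acting as 4-cycles, one for each pair of fixed points. -/
def fourCycleWords : List (List Bool) :=
  [[false], [true], [false, false, false, true, false], [false, false, true, false, false],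
    [false, false, true, false, true], [false, true, false, false, true],
    [false, true, false, true, true], [false, true, true, false, true],
    [true, false, false, true, false], [true, false, true, true, false],
    [true, false, true, true, true], [false, false, true, false, true, true],
    [false, true, false, true, true, false], [false, true, true, false, true, false],
    [true, true, false, true, false, false]]

theorem length_le_of_mem_fourCycleWords : ∀ l ∈ fourCycleWords, l.length ≤ 6 := by
  decide

-- A finite check; `s = s'` is allowed.
set_option maxRecDepth 10000 in
theorem exists_mem_fourCycleWords : ∀ t s s' : Fin 6, t ≠ s → t ≠ s' →
    ∃ l ∈ fourCycleWords, wordFun l t ≠ t ∧ wordFun l s = s ∧ wordFun l s' = s' := by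
  decide

/-- Up to three of the six vertices are separated by one of the words: all but one are fixed. -/
theorem exists_word_moving_one {T : Finset (Fin 6)} (hT : T.Nonempty) (h3 : T.card ≤ 3) :
    ∃ l : List Bool, l.length ≤ 6 ∧ ∃ t ∈ T, wordFun l t ≠ t ∧
      ∀ s ∈ T, s ≠ t → wordFun l s = s := by
  obtain ⟨t, ht⟩ := hT
  have h2 : (T.erase t).card ≤ 2 := by rw [Finset.card_erase_of_mem ht]; omega
  -- The points to be fixed are padded to exactly two, still avoiding `t`.
  obtain ⟨U, hU, hU', hUc⟩ := Finset.exists_subsuperset_card_eq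
    (Finset.erase_subset_erase t (Finset.subset_univ T)) h2
    (by rw [Finset.card_erase_of_mem (Finset.mem_univ t)]; simp)
  obtain ⟨s, s', hss, rfl⟩ := Finset.card_eq_two.1 hUc
  obtain ⟨l, hl, hlt, hls, hls'⟩ := exists_mem_fourCycleWords t s s'
    (Finset.ne_of_mem_erase (hU' (by simp))).symm (Finset.ne_of_mem_erase (hU' (by simp))).symm
  refine ⟨l, length_le_of_mem_fourCycleWords l hl, t, ht, hlt, fun r hr hrt => ?_⟩
  have := hU (Finset.mem_erase.2 ⟨hrt, hr⟩)
  simp only [Finset.mem_insert, Finset.mem_singleton] at this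
  rcases this with rfl | rfl
  · exact hls
  · exact hls'

theorem wordPerm_apply_of_fixed {α : Type*} {a b : Perm α} {w : α} (ha : a w = w) (hb : b w = w)
    (l : List Bool) : wordPerm a b l w = w := by
  induction l with
  | nil => rfl
  | cons c l ih =>
    have h : wordPerm a b (c :: l) = (if c then b else a) * wordPerm a b l := by
      simp [wordPerm]
    rw [h, Perm.mul_apply, ih]
    cases c
    · exact ha
    · exact hb

variable {V : Type*} [DecidableEq V] {G : SimpleGraph V} {𝒞 R : Set (GraphCycle G)}

theorem GeneratedInAtMost.wordPerm {a b : Perm V} (ha : GeneratedInAtMost 𝒞 a 1)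
    (hb : GeneratedInAtMost 𝒞 b 1) (l : List Bool) :
    GeneratedInAtMost 𝒞 (wordPerm a b l) l.length := by
  have h := GeneratedInAtMost.prod (𝒞 := 𝒞) (l := l.map fun i => if i then b else a) (N := 1) (by
    simp only [List.mem_map]
    rintro σ ⟨i, -, rfl⟩
    cases i
    · exact ha
    · exact hb)
  rwa [List.length_map, mul_one] at h

namespace GraphCycle

/-- A shift along `C` in the direction taking `u` to its neighbour `v`. -/
theorem exists_shift_of_consecutive {C : GraphCycle G} (hC : C ∈ 𝒞) {u v : V}
    (h : C.Consecutive u v) :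
    ∃ a : Perm V, GeneratedInAtMost 𝒞 a 1 ∧ a.IsCycleOn (C.toCycle.toFinset : Set V) ∧
      (∀ x, a x ≠ x ↔ x ∈ C.verts) ∧ a u = v := by
  rcases h.2.2 with h | h
  · exact ⟨C.perm, .perm hC, C.isCycleOn_perm, fun x => C.perm_apply_ne_iff, h⟩
  · refine ⟨C.perm⁻¹, (GeneratedInAtMost.perm hC).inv, C.isCycleOn_perm.inv, fun x => ?_, ?_⟩
    · rw [← C.perm_apply_ne_iff, Ne, Perm.inv_eq_iff_eq, eq_comm]
    · rw [Perm.inv_eq_iff_eq, h]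

theorem perm_eq_swap {C : GraphCycle G} (h2 : C.length = 2) {u v : V} (huv : u ≠ v)
    (hu : u ∈ C.verts) (hv : v ∈ C.verts) : C.perm = swap u v := by
  have hmem : ∀ w ∈ C.verts, w = u ∨ w = v := by
    intro w hw
    rw [← C.coe_toFinset] at hu hv hw
    have hsub : ({u, v} : Finset V) ⊆ C.toCycle.toFinset := by
      intro z hz
      simp only [Finset.mem_insert, Finset.mem_singleton] at hz
      rcases hz with rfl | rfl
      · exact hu
      · exact hv
    have heq := Finset.eq_of_subset_of_card_le hsub
      (by rw [C.card_toFinset, h2, Finset.card_pair huv])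
    have : w ∈ ({u, v} : Finset V) := heq ▸ hw
    simpa using this
  have hne : ∀ w ∈ C.verts, C.perm w ≠ w := fun w hw => C.perm_apply_ne_iff.2 hw
  have hin : ∀ w ∈ C.verts, C.perm w ∈ C.verts := fun w hw =>
    C.perm_apply_ne_iff.1 fun e => hne w hw (C.perm.injective e)
  ext w
  by_cases hwu : w = u
  · subst hwu
    rw [swap_apply_left]
    exact (hmem _ (hin w hu)).resolve_left (hne w hu)
  by_cases hwv : w = v
  · subst hwv
    rw [swap_apply_right]
    exact (hmem _ (hin w hv)).resolve_right (hne w hv)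
  · rw [swap_apply_of_ne_of_ne hwu hwv]
    by_contra hc
    exact (hmem w (C.perm_apply_ne_iff.1 hc)).elim hwu hwv

/-- A cyclic sequence is lost in its permutation only when its length is at most one. -/
theorem eq_of_perm_eq {C D : GraphCycle G} (h : C.perm = D.perm) : C = D := by
  refine GraphCycle.ext ?_
  rcases Cycle.formPerm_eq_formPerm_iff.1 h with h | h
  · exact h
  · exact absurd (C.two_le_length.trans h.1) (by decide)

end GraphCycle

end CyclicShift

/-! ### A cheap 3-cycle in every puzzle -/

namespace CyclicShift

variable {V : Type*} [DecidableEq V] {G : SimpleGraph V} {𝒞 R : Set (GraphCycle G)}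

theorem GeneratedInAtMost.commutator {f g : Perm V} {M N : ℕ} (hf : GeneratedInAtMost 𝒞 f M)
    (hg : GeneratedInAtMost 𝒞 g N) :
    GeneratedInAtMost 𝒞 (f * g * f⁻¹ * g⁻¹) (M + N + M + N) :=
  ((hf.mul hg).mul hf.inv).mul hg.inv

section

variable [Fintype V]

theorem exists_isThreeCycle_of_inter_eq_singleton {C D : GraphCycle G} (hC : C ∈ 𝒞) (hD : D ∈ 𝒞)
    {v : V} (h : C.verts ∩ D.verts = {v}) :
    ∃ g : Perm V, g.IsThreeCycle ∧ GeneratedInAtMost 𝒞 g 4 := by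
  have hv : v ∈ C.verts ∩ D.verts := h ▸ rfl
  exact ⟨_, isThreeCycle_commutator (C.perm_apply_ne_iff.2 hv.1) (D.perm_apply_ne_iff.2 hv.2)
    fun y hy hy' => h.subset ⟨C.perm_apply_ne_iff.1 hy, D.perm_apply_ne_iff.1 hy'⟩,
    (GeneratedInAtMost.perm hC).commutator (GeneratedInAtMost.perm hD)⟩

theorem isThreeCycle_perm {C : GraphCycle G} (h : C.length = 3) : C.perm.IsThreeCycle := by
  rw [← card_support_eq_three_iff, GraphCycle.perm, Cycle.support_formPerm _ _ C.nontrivial,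
    C.card_toFinset, h]

end

/-- Iterating a shift fewer times than the length of the cycle moves every vertex. -/
theorem pow_apply_ne_of_lt_length {C : GraphCycle G} {a : Perm V}
    (ha : a.IsCycleOn (C.toCycle.toFinset : Set V)) {u : V} (hu : u ∈ C.verts) {k : ℕ}
    (hk : 0 < k) (hkC : k < C.length) : (a ^ k) u ≠ u := by
  rw [← C.coe_toFinset] at hu
  intro e
  have := (ha.pow_apply_eq hu).1 e
  rw [C.card_toFinset] at this
  exact absurd (Nat.le_of_dvd hk this) (by omega)

section

variable [Fintype V]

/-- The shift along `C` is the transposition of `u` and `v`; conjugated by a shift `b` along `D` it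
becomes that of `v` and `b v`. As `D ≠ C` has length above two, the two transpositions share only
`v`. -/
theorem exists_isThreeCycle_of_length_two {C D : GraphCycle G} (hC : C ∈ 𝒞) (hD : D ∈ 𝒞)
    (hne : C ≠ D) {u v : V} (huv : u ≠ v) (hCc : C.Consecutive u v) (hDc : D.Consecutive u v)
    (h2 : C.length = 2) : ∃ g : Perm V, g.IsThreeCycle ∧ GeneratedInAtMost 𝒞 g 8 := by
  have hCs := GraphCycle.perm_eq_swap h2 huv hCc.1 hCc.2.1
  have hD2 : 2 < D.length := by
    refine lt_of_le_of_ne D.two_le_length fun e => hne (GraphCycle.eq_of_perm_eq ?_)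
    rw [hCs, GraphCycle.perm_eq_swap e.symm huv hDc.1 hDc.2.1]
  obtain ⟨b, hb, hbc, hbm, hbu⟩ := GraphCycle.exists_shift_of_consecutive hD hDc
  have hb2 : b v ≠ u := by
    have := pow_apply_ne_of_lt_length hbc hDc.1 (k := 2) (by norm_num) hD2
    rwa [pow_two, Perm.mul_apply, hbu] at this
  have hbv : b v ≠ v := (hbm v).2 hDc.2.1
  have hbi : b⁻¹ v = u := by rw [Perm.inv_eq_iff_eq, hbu]
  have hmoved : ∀ y, swap u v y ≠ y → y = u ∨ y = v := fun y hy => by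
    by_contra! hc
    exact hy (swap_apply_of_ne_of_ne hc.1 hc.2)
  refine ⟨_, isThreeCycle_commutator (f := C.perm) (g := b * C.perm * b⁻¹) (x := v) ?_ ?_ ?_,
    (GeneratedInAtMost.perm hC).commutator ((hb.mul (.perm hC)).mul hb.inv)⟩
  · rw [hCs, swap_apply_right]; exact huv
  · rw [Perm.mul_apply, Perm.mul_apply, hbi, hCs, swap_apply_left]; exact hbv
  · intro y hy hy'
    rw [hCs] at hy hy'
    refine (hmoved y hy).resolve_left ?_
    rintro rfl
    have h3 : swap y v (b⁻¹ y) ≠ b⁻¹ y := fun e => hy' (by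
      rw [Perm.mul_apply, Perm.mul_apply, e]; exact b.apply_symm_apply y)
    rcases hmoved _ h3 with h | h
    · rw [Perm.inv_eq_iff_eq, hbu] at h; exact huv h
    · rw [Perm.inv_eq_iff_eq] at h; exact hb2 h.symm

theorem exists_isThreeCycle_of_five_le_length {C D : GraphCycle G} (hC : C ∈ 𝒞) (hD : D ∈ 𝒞)
    {u v : V} (huv : u ≠ v) (h : C.verts ∩ D.verts = {u, v}) (hCc : C.Consecutive u v)
    (hDc : D.Consecutive u v) (h4 : 4 ≤ C.length) (h5 : 5 ≤ D.length) :
    ∃ g : Perm V, g.IsThreeCycle ∧ GeneratedInAtMost 𝒞 g 28 := by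
  obtain ⟨a, ha, hac, ham, hau⟩ := GraphCycle.exists_shift_of_consecutive hC hCc
  obtain ⟨b, hb, hbc, hbm, hbu⟩ := GraphCycle.exists_shift_of_consecutive hD hDc
  have key := isThreeCycle_sq_commutator_mul hau hbu huv
    (fun w hw hw' => h.subset ⟨(ham w).1 hw, (hbm w).1 hw'⟩)
    (by simpa [pow_succ, hau] using pow_apply_ne_of_lt_length hac hCc.1 (k := 2) (by omega) (by omega))
    (by simpa [pow_succ, hau] using pow_apply_ne_of_lt_length hac hCc.1 (k := 3) (by omega) (by omega))
    (by simpa [pow_succ, hbu] using pow_apply_ne_of_lt_length hbc hDc.1 (k := 2) (by omega) (by omega))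
    (by simpa [pow_succ, hbu] using pow_apply_ne_of_lt_length hbc hDc.1 (k := 3) (by omega) (by omega))
    (by simpa [pow_succ, hbu] using pow_apply_ne_of_lt_length hbc hDc.1 (k := 4) (by omega) (by omega))
  -- The cost is 4 + (3 + 4 + 3) = 14, doubled by squaring.
  have hb3 := (hb.mul hb).mul hb
  have hk := (hb.commutator ha).mul
    ((hb3.mul (((hb.inv.mul ha.inv).mul hb).mul ha)).mul hb3.inv)
  exact ⟨_, key, hk.mul hk⟩

/-- Two 4-cycles sharing an edge, together with a third 4-cycle that meets their union and
leaves it, yield a 3-cycle. -/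
theorem exists_isThreeCycle_of_length_four {A B C : GraphCycle G} (hA : A ∈ 𝒞) (hB : B ∈ 𝒞)
    (hC : C ∈ 𝒞) {u v : V} (huv : u ≠ v) (h : A.verts ∩ B.verts = {u, v})
    (hAc : A.Consecutive u v) (hBc : B.Consecutive u v) (hA4 : A.length = 4)
    (hB4 : B.length = 4) (hC4 : C.length = 4)
    (hmeet : (C.verts ∩ (A.verts ∪ B.verts)).Nonempty)
    (hleave : ¬ C.verts ⊆ A.verts ∪ B.verts) :
    ∃ g : Perm V, g.IsThreeCycle ∧ GeneratedInAtMost 𝒞 g 14 := by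
  obtain ⟨a, ha, hac, ham, hau⟩ := GraphCycle.exists_shift_of_consecutive hA hAc
  obtain ⟨b, hb, hbc, hbm, hbu⟩ := GraphCycle.exists_shift_of_consecutive hB hBc
  have hpow : ∀ {E : GraphCycle G} {f : Perm V}, E.length = 4 → E.Consecutive u v →
      f.IsCycleOn (E.toCycle.toFinset : Set V) → f u = v →
      f v ≠ u ∧ f (f v) ≠ u ∧ f (f (f v)) = u ∧
      ∀ w, w ∈ E.verts ↔ w = u ∨ w = v ∨ w = f v ∨ w = f (f v) := by
    intro E f hE4 hEc hf hfu
    have hu := hEc.1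
    rw [← E.coe_toFinset] at hu
    have h4 : f (f (f v)) = u := by
      have := hf.pow_card_apply hu
      rw [E.card_toFinset, hE4] at this
      simpa [pow_succ, hfu] using this
    refine ⟨by simpa [pow_succ, hfu] using pow_apply_ne_of_lt_length hf hEc.1 (k := 2) (by omega) (by omega),
      by simpa [pow_succ, hfu] using pow_apply_ne_of_lt_length hf hEc.1 (k := 3) (by omega) (by omega),
      h4, fun w => ⟨fun hw => ?_, ?_⟩⟩
    · rw [← E.coe_toFinset] at hw
      obtain ⟨i, hi, rfl⟩ := hf.exists_pow_eq hu hw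
      rw [E.card_toFinset, hE4] at hi
      interval_cases i <;> simp [pow_succ, hfu]
    · have hv : v ∈ (E.toCycle.toFinset : Set V) := hfu ▸ hf.apply_mem_iff.2 hu
      rw [← E.coe_toFinset]
      rintro (rfl | rfl | rfl | rfl)
      · exact hu
      · exact hv
      · exact hf.apply_mem_iff.2 hv
      · exact hf.apply_mem_iff.2 (hf.apply_mem_iff.2 hv)
  obtain ⟨ha2, ha3, ha4, hamem⟩ := hpow hA4 hAc hac hau
  obtain ⟨hb2, hb3, hb4, hbmem⟩ := hpow hB4 hBc hbc hbu
  have hab : ∀ w, a w ≠ w → b w ≠ w → w = u ∨ w = v :=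
    fun w hw hw' => h.subset ⟨(ham w).1 hw, (hbm w).1 hw'⟩
  have hav : a v ≠ v := (ham v).2 hAc.2.1
  have hbv : b v ≠ v := (hbm v).2 hBc.2.1
  have haav : a (a v) ≠ a v := fun e => hav (a.injective e)
  have hbbv : b (b v) ≠ b v := fun e => hbv (b.injective e)
  have haav' : a (a v) ≠ v := fun e => ha2 (a.injective (e.trans hau.symm))
  have hbbv' : b (b v) ≠ v := fun e => hb2 (b.injective (e.trans hbu.symm))
  have hba1 : b (a v) = a v := by
    by_contra hc
    exact (hab _ haav hc).elim ha2 hav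
  have hba2 : b (a (a v)) = a (a v) := by
    by_contra hc
    exact (hab _ (fun e => haav (a.injective e)) hc).elim ha3 haav'
  have hab1 : a (b v) = b v := by
    by_contra hc
    exact (hab _ hc hbbv).elim hb2 hbv
  have hab2 : a (b (b v)) = b (b v) := by
    by_contra hc
    exact (hab _ hc (fun e => hbbv (b.injective e))).elim hb3 hbbv'
  have hd : ∀ w, a w = w → w ≠ a v ∧ w ≠ a (a v) := fun w hw =>
    ⟨fun e => haav (e ▸ hw), fun e => haav (a.injective (e ▸ hw))⟩
  -- The labelling used by `wordFun`, with the shared edge at 0 and 1.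
  let e : Fin 6 → V := ![u, v, a v, a (a v), b v, b (b v)]
  have hinj : Function.Injective e := by
    have hl : [u, v, a v, a (a v), b v, b (b v)].Nodup := by
      simp only [List.nodup_cons, List.mem_cons, List.not_mem_nil, or_false, not_or,
        not_false_eq_true, List.nodup_nil, and_true]
      exact ⟨⟨huv, ha2.symm, ha3.symm, hb2.symm, hb3.symm⟩,
        ⟨hav.symm, haav'.symm, hbv.symm, hbbv'.symm⟩,
        ⟨haav.symm, (hd _ hab1).1.symm, (hd _ hab2).1.symm⟩,
        ⟨(hd _ hab1).2.symm, (hd _ hab2).2.symm⟩, hbbv.symm⟩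
    have := List.nodup_iff_injective_get.1 hl
    intro i j hij
    refine this ?_
    revert hij
    fin_cases i <;> fin_cases j <;> exact id
  have hea : ∀ i, a (e i) = e (![1, 2, 3, 0, 4, 5] i) := by
    intro i
    fin_cases i
    exacts [hau, rfl, rfl, ha4, hab1, hab2]
  have heb : ∀ i, b (e i) = e (![1, 4, 2, 3, 5, 0] i) := by
    intro i
    fin_cases i
    exacts [hbu, rfl, hba1, hba2, rfl, hb4]
  have hrange : ∀ w, w ∈ A.verts ∪ B.verts ↔ ∃ i, e i = w := by
    intro w
    rw [Set.mem_union, hamem, hbmem]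
    constructor
    · rintro ((rfl | rfl | rfl | rfl) | (rfl | rfl | rfl | rfl))
      exacts [⟨0, rfl⟩, ⟨1, rfl⟩, ⟨2, rfl⟩, ⟨3, rfl⟩, ⟨0, rfl⟩, ⟨1, rfl⟩, ⟨4, rfl⟩, ⟨5, rfl⟩]
    · rintro ⟨i, rfl⟩
      fin_cases i <;> simp [e]
  obtain ⟨z, hzC, hz⟩ := Set.not_subset.1 hleave
  obtain ⟨y, hyC, hy⟩ := hmeet
  classical
  let T : Finset (Fin 6) := Finset.univ.filter fun i => e i ∈ C.verts
  have hT : T.Nonempty := by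
    obtain ⟨i, rfl⟩ := (hrange y).1 hy
    exact ⟨i, by simpa [T] using hyC⟩
  -- One of the four vertices of `C`, namely `z`, is outside the union.
  have hT3 : T.card ≤ 3 := by
    have hsub : T.image e ⊆ C.toCycle.toFinset.erase z := by
      intro w hw
      obtain ⟨i, hi, rfl⟩ := Finset.mem_image.1 hw
      have hi' : e i ∈ C.verts := by simpa [T] using hi
      rw [← C.coe_toFinset] at hi'
      refine Finset.mem_erase.2 ⟨?_, hi'⟩
      rintro rfl
      exact hz ((hrange _).2 ⟨i, rfl⟩)
    rw [← C.coe_toFinset] at hzC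
    have := Finset.card_le_card hsub
    rwa [Finset.card_image_of_injective _ hinj, Finset.card_erase_of_mem hzC, C.card_toFinset,
      hC4] at this
  -- The support of this word meets `C` in the single vertex `e t`, so its commutator with the shift
  -- along `C` is a 3-cycle.
  obtain ⟨l, hl, t, htT, ht, hs⟩ := exists_word_moving_one hT hT3
  have hcomm := ((ha.wordPerm hb l).mono hl).commutator (.perm hC)
  refine ⟨_, isThreeCycle_commutator (x := e t) ?_ ?_ ?_, hcomm⟩
  · rw [wordPerm_apply hea heb]
    exact fun hc => ht (hinj hc)
  · exact C.perm_apply_ne_iff.2 (by simpa [T] using htT)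
  · intro w hw hw'
    have hwS : w ∈ A.verts ∪ B.verts := by
      by_contra hc
      rw [Set.mem_union, not_or, ← ham, ← hbm, not_not, not_not] at hc
      exact hw (wordPerm_apply_of_fixed hc.1 hc.2 l)
    obtain ⟨i, rfl⟩ := (hrange w).1 hwS
    by_contra hc
    refine hw ?_
    rw [wordPerm_apply hea heb, hs i (by simpa [T] using C.perm_apply_ne_iff.1 hw')
      fun hit => hc (by rw [hit])]

theorem exists_isThreeCycle (hRC : R ⊆ 𝒞)
    (hR : ((interconnectionGraph G).induce R).Connected) (hnt : R.Nontrivial)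
    (hcov : ∀ v : V, ∃ C ∈ R, v ∈ C.verts) (h6 : 6 < Fintype.card V) :
    ∃ g : Perm V, g.IsThreeCycle ∧ GeneratedInAtMost 𝒞 g 28 := by
  by_cases hone : ∃ C ∈ R, ∃ D ∈ R, ∃ v, C.verts ∩ D.verts = {v}
  · obtain ⟨C, hC, D, hD, v, hv⟩ := hone
    obtain ⟨g, hg, hgT⟩ := exists_isThreeCycle_of_inter_eq_singleton (hRC hC) (hRC hD) hv
    exact ⟨g, hg, hgT.mono (by norm_num)⟩
  have hnbr : ∀ C ∈ R, ∃ D ∈ R, C ≠ D ∧ ∃ u v, u ≠ v ∧ C.verts ∩ D.verts = {u, v} ∧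
      C.Consecutive u v ∧ D.Consecutive u v := by
    intro C hC
    obtain ⟨D, hD, hne, h | h⟩ := exists_properlyInterconnected hR hnt hC
    · exact absurd ⟨C, hC, D, hD, h⟩ hone
    · exact ⟨D, hD, hne, h⟩
  by_cases hthree : ∃ C ∈ R, C.length = 3
  · obtain ⟨C, hC, h3⟩ := hthree
    exact ⟨C.perm, isThreeCycle_perm h3, (GeneratedInAtMost.perm (hRC hC)).mono (by norm_num)⟩
  by_cases htwo : ∃ C ∈ R, C.length = 2
  · obtain ⟨C, hC, h2⟩ := htwo
    obtain ⟨D, hD, hne, u, v, huv, -, hCc, hDc⟩ := hnbr C hC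
    obtain ⟨g, hg, hgT⟩ :=
      exists_isThreeCycle_of_length_two (hRC hC) (hRC hD) hne huv hCc hDc h2
    exact ⟨g, hg, hgT.mono (by norm_num)⟩
  have hfour : ∀ C ∈ R, 4 ≤ C.length := by
    intro C hC
    have h1 := C.two_le_length
    have h2 : C.length ≠ 2 := fun e => htwo ⟨C, hC, e⟩
    have h3 : C.length ≠ 3 := fun e => hthree ⟨C, hC, e⟩
    change 2 ≤ C.length at h1
    omega
  by_cases hfive : ∃ D ∈ R, 5 ≤ D.length
  · obtain ⟨D, hD, h5⟩ := hfive
    obtain ⟨C, hC, -, u, v, huv, hDC, hDc, hCc⟩ := hnbr D hD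
    rw [Set.inter_comm] at hDC
    exact exists_isThreeCycle_of_five_le_length (hRC hC) (hRC hD) huv hDC hCc hDc (hfour C hC) h5
  have hlen : ∀ C ∈ R, C.length = 4 := by
    intro C hC
    have h1 := hfour C hC
    have h2 : ¬ 5 ≤ C.length := fun e => hfive ⟨C, hC, e⟩
    omega
  obtain ⟨A, hA⟩ := hnt.nonempty
  obtain ⟨B, hB, -, u, v, huv, hAB, hAc, hBc⟩ := hnbr A hA
  -- All relevant cycles now have length four. This is where n > 6 enters: `A` and `B` cover at most
  -- 4 + 4 - 2 vertices.
  have hcard : (A.toCycle.toFinset ∪ B.toCycle.toFinset).card ≤ 6 := by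
    have hsub : ({u, v} : Finset V) ⊆ A.toCycle.toFinset ∩ B.toCycle.toFinset := by
      rw [← Finset.coe_subset, Finset.coe_inter, A.coe_toFinset, B.coe_toFinset, hAB]
      simp
    have h1 := Finset.card_le_card hsub
    rw [Finset.card_pair huv] at h1
    have h2 := Finset.card_union_add_card_inter A.toCycle.toFinset B.toCycle.toFinset
    rw [A.card_toFinset, B.card_toFinset, hlen A hA, hlen B hB] at h2
    omega
  have hne : A.verts ∪ B.verts ≠ Set.univ := by
    intro e
    rw [← A.coe_toFinset, ← B.coe_toFinset, ← Finset.coe_union, Finset.coe_eq_univ] at e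
    rw [e, Finset.card_univ] at hcard
    omega
  obtain ⟨C, hC, hmeet, hleave⟩ : ∃ C ∈ R, (C.verts ∩ (A.verts ∪ B.verts)).Nonempty ∧
      ¬ C.verts ⊆ A.verts ∪ B.verts := by
    by_contra! hc
    exact hne (eq_univ_of_forall_subset hR hcov ⟨u, Or.inl hAc.1⟩ hc)
  obtain ⟨g, hg, hgT⟩ := exists_isThreeCycle_of_length_four (hRC hA) (hRC hB) (hRC hC) huv hAB
    hAc hBc (hlen A hA) (hlen B hB) (hlen C hC) hmeet hleave
  exact ⟨g, hg, hgT.mono (by norm_num)⟩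

theorem sign_eq_one_of_mem (hodd : ∀ C ∈ 𝒞, Odd C.length) {π : Perm V}
    (hπ : π ∈ configurationGroup 𝒞) : sign π = 1 := by
  have h : Relation.ReflTransGen (tokenShiftingGraph 𝒞).Adj 1 π :=
    (SimpleGraph.reachable_iff_reflTransGen _ _).1 hπ
  induction h with
  | refl => exact Perm.sign_one
  | @tail f f' hf hadj ih =>
    have hs := ih ((SimpleGraph.reachable_iff_reflTransGen _ _).2 hf)
    obtain ⟨-, C, hC, h⟩ := hadj
    have hsC : sign C.perm = 1 := by rw [C.sign_perm, (hodd C hC).neg_one_pow, neg_neg]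
    rcases h with h | h
    · have e : f' * C.perm = f := Perm.ext fun v => h v
      rwa [← e, Perm.sign_mul, hsC, mul_one] at hs
    · have e : f * C.perm = f' := Perm.ext fun v => h v
      rw [← e, Perm.sign_mul, hsC, hs, mul_one]

end

end CyclicShift

/-! ### The main theorem -/

theorem theorem3 :
    ∃ K : ℕ, ∀ (V : Type*) [Fintype V] [DecidableEq V] (G : SimpleGraph V)
      (𝒞 : Set (CyclicShift.GraphCycle G)), CyclicShift.IsGeneralizedPuzzle 𝒞 →
        ((∀ C ∈ 𝒞, Odd C.length) →
          CyclicShift.configurationGroup 𝒞 = alternatingGroup V) ∧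
        (¬ (∀ C ∈ 𝒞, Odd C.length) →
          CyclicShift.configurationGroup 𝒞 = ⊤) ∧
        ∀ π ∈ CyclicShift.configurationGroup 𝒞,
          CyclicShift.GeneratedInAtMost 𝒞 π (K * Fintype.card V ^ 5) := by
  -- 31 = 2 + 28 + 1, the coefficients of the bound 2n⁴ + 28n + 1.
  refine ⟨31, fun V _ _ G 𝒞 ⟨h6, R, hRC, hnt, hR, hcov⟩ => ?_⟩
  obtain ⟨g, hg, hgT⟩ := CyclicShift.exists_isThreeCycle hRC hR hnt hcov h6
  have hA : alternatingGroup V ≤ CyclicShift.configurationGroup 𝒞 :=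
    alternatingGroup_le_of_isPreprimitive_of_isThreeCycle_mem
      (CyclicShift.isPreprimitive_of_perm_mem hR hnt hcov
        fun C hC => (CyclicShift.GeneratedInAtMost.perm (hRC hC)).mem) hg hgT.mem
  have heven : ∀ π : Perm V, sign π = 1 → CyclicShift.GeneratedInAtMost 𝒞 π
      (Fintype.card V * (2 * Fintype.card V ^ 3 + 28)) := fun π hπ =>
    CyclicShift.generatedInAtMost_of_sign_eq_one hA (by omega) hg hgT hπ
  have hodd : ¬ (∀ C ∈ 𝒞, Odd C.length) → ∀ π : Perm V, CyclicShift.GeneratedInAtMost 𝒞 π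
      (Fintype.card V * (2 * Fintype.card V ^ 3 + 28) + 1) := by
    intro h π
    push Not at h
    obtain ⟨C, hC, hCe⟩ := h
    rcases Int.units_eq_one_or (sign π) with hπ | hπ
    · exact (heven π hπ).mono (Nat.le_succ _)
    -- One shift along a cycle of even length corrects the parity.
    · have hs : sign (π * C.perm⁻¹) = 1 := by
        rw [Perm.sign_mul, Perm.sign_inv, C.sign_perm, (Nat.not_odd_iff_even.1 hCe).neg_one_pow, hπ]
        decide
      have := (heven _ hs).mul (CyclicShift.GeneratedInAtMost.perm hC)
      rwa [inv_mul_cancel_right] at this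
  refine ⟨fun h => le_antisymm (fun π hπ => ?_) hA, fun h => ?_, fun π hπ => ?_⟩
  · exact mem_alternatingGroup.2 (CyclicShift.sign_eq_one_of_mem h hπ)
  · exact eq_top_iff.2 fun π _ => (hodd h π).mem
  · have hbound : Fintype.card V * (2 * Fintype.card V ^ 3 + 28) + 1 ≤
        31 * Fintype.card V ^ 5 := by
      have h1 : 1 ≤ Fintype.card V := by omega
      have h5 : 1 ≤ Fintype.card V ^ 5 := Nat.one_le_pow _ _ h1
      have h45 : Fintype.card V ^ 4 ≤ Fintype.card V ^ 5 := Nat.pow_le_pow_right h1 (by omega)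
      have h15 : Fintype.card V ^ 1 ≤ Fintype.card V ^ 5 := Nat.pow_le_pow_right h1 (by omega)
      calc Fintype.card V * (2 * Fintype.card V ^ 3 + 28) + 1
          = 2 * Fintype.card V ^ 4 + 28 * Fintype.card V ^ 1 + 1 := by ring
        _ ≤ 31 * Fintype.card V ^ 5 := by omega
    by_cases h : ∀ C ∈ 𝒞, Odd C.length
    · exact (heven π (CyclicShift.sign_eq_one_of_mem h hπ)).mono
        ((Nat.le_succ _).trans hbound)
    · exact (hodd h π).mono hbound
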